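/- Let $E=(E^0,E^1,r,s)$ be a finite directed graph (finitely many vertices and edges; parallel edges allowed) that is acyclic, i.e. without directed cycles, and let $k\ge 1$ be an integer. Let $C^*(E)$ be the graph $C^*$-algebra of $E$: the universal $C^*$-algebra generated by mutually orthogonal projections $P_v$ ($v\in E^0$) and partial isometries $S_e$ ($e\in E^1$) with mutually orthogonal ranges, subject to $S_e^*S_e=P_{r(e)}$, $S_eS_e^*\le P_{s(e)}$, and $P_v=\sum_{s(e)=v}S_eS_e^*$ for every $v\in E^0$ that emits at least one edge. The gauge action of $\mathbb Z/k=\{z\in\mathbb S^1: z^k=1\}$ on $C^*(E)$ is the action $\alpha$ by automorphisms with $\alpha_z(S_e)=zS_e$ and $\alpha_z(P_v)=P_v$. An action $\alpha$ of a compact group $G$ on a $C^*$-algebra $A$ is free (in the sense of Ellwood) if the linear span of the functions $g\mapsto a\,\alpha_g(b)$, $a,b\in A$, is norm dense in $C(G,A)\cong A\otimes C(G)$. If $A$ is unital, the weak local-triviality dimension $\dim^G_{\mathrm{WLT}}(A)\in\{0,1,2,\dots,\infty\}$ is the smallest $n$ for which there are $G$-equivariant $*$-homomorphisms $\rho_0,\dots,\rho_n: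 C_0((0,1])\otimes C(G)\to A$ such that $\sum_{i=0}^n\rho_i(t\otimes 1)$ is invertible, where $t$ is the identity function on $(0,1]$ and $G$ acts on $C(G)$ by $(g\cdot f)(h)=f(hg)$ and trivially on $C_0((0,1])$; it is $\infty$ if there is no such $n$. Then the following are equivalent: (a) the gauge action of $\mathbb Z/k$ on $C^*(E)$ is free; (b) $\dim^{\mathbb Z/k}_{\mathrm{WLT}}(C^*(E))<\infty$; (c) for every sink $v$ of $E$ (a vertex that emits no edge) there is a directed path of length $k-1$ in $E$ that ends at $v$ (a path of length $0$ being a single vertex). -/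

import Mathlib

open scoped ENNReal ZeroAtInfty

universe u v

noncomputable section

namespace GraphCStar

lemma continuous_hom {A B : Type*} [NonUnitalCStarAlgebra A] [NonUnitalCStarAlgebra B]
    (φ : A →⋆ₙₐ[ℂ] B) : Continuous φ :=
  AddMonoidHomClass.continuous_of_bound φ 1 fun a => by
    simpa using NonUnitalStarAlgHom.norm_apply_le φ a

/-! ### Directed graphs

A directed graph (loops and parallel edges allowed) is a `Quiver V`: the vertex set is `V`, the edge
set is `Quiver.Total V`, and the edge `e` has source `e.left` and range `e.right`. -/

/-- A graph is acyclic if it has no directed cycle, i.e. no path of positive length from a vertex to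
itself. -/
def IsAcyclic (V : Type u) [Quiver.{v} V] : Prop :=
  ∀ (x : V) (p : Quiver.Path x x), p.length = 0

/-- A sink is a vertex that emits no edge. -/
def IsSink {V : Type u} [Quiver.{v} V] (x : V) : Prop :=
  ∀ e : Quiver.Total V, e.left ≠ x

/-! ### Graph C*-algebras -/

/-- A family of elements `P_x` (for the vertices) and `S_e` (for the edges) of a C*-algebra `B` that
satisfies the defining relations of the graph C*-algebra. The inequality `S_e S_e* ≤ P_{s(e)}`
between projections is written as `P_{s(e)} (S_e S_e*) = S_e S_e*`. -/
@[ext]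
structure Family (V : Type u) [Quiver.{v} V] (B : Type*) [NonUnitalCStarAlgebra B] where
  P : V → B
  S : Quiver.Total V → B
  proj : ∀ x, IsStarProjection (P x)
  orth : ∀ x y, x ≠ y → P x * P y = 0
  partial_isometry : ∀ e, S e * star (S e) * S e = S e
  range_orth : ∀ e f, e ≠ f → (S e * star (S e)) * (S f * star (S f)) = 0
  star_S_mul_S : ∀ e, star (S e) * S e = P e.right
  range_le : ∀ e, P e.left * (S e * star (S e)) = S e * star (S e)
  sum_range : ∀ (x : V) [Fintype {e : Quiver.Total V // e.left = x}]
    [Nonempty {e : Quiver.Total V // e.left = x}],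
    P x = ∑ e : {e : Quiver.Total V // e.left = x}, S e.1 * star (S e.1)

namespace Family

variable {V : Type u} [Quiver.{v} V] {B : Type*} [NonUnitalCStarAlgebra B]

lemma norm_P_le (F : Family V B) (x : V) : ‖F.P x‖ ≤ 1 := (F.proj x).norm_le

lemma norm_S_le (F : Family V B) (e : Quiver.Total V) : ‖F.S e‖ ≤ 1 := by
  have h : ‖F.S e‖ * ‖F.S e‖ ≤ 1 := by
    rw [← CStarRing.norm_star_mul_self, F.star_S_mul_S]
    exact F.norm_P_le _
  nlinarith [norm_nonneg (F.S e)]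

/-- The family `(P_x, z S_e)` for a complex number `z` of modulus one. -/
def twist (z : Circle) (F : Family V B) : Family V B where
  P := F.P
  S e := (z : ℂ) • F.S e
  proj := F.proj
  orth := F.orth
  partial_isometry e := by
    have hz : (z : ℂ) * star (z : ℂ) = 1 := by
      simpa using Complex.mul_conj (z : ℂ)
    simp only [star_smul, smul_mul_smul_comm, hz, one_mul, F.partial_isometry]
  range_orth e f h := by
    have hz : (z : ℂ) * star (z : ℂ) = 1 := by
      simpa using Complex.mul_conj (z : ℂ)
    simp only [star_smul, smul_mul_smul_comm, hz, one_smul, F.range_orth e f h]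
  star_S_mul_S e := by
    have hz : star (z : ℂ) * (z : ℂ) = 1 := by
      rw [mul_comm]; simpa using Complex.mul_conj (z : ℂ)
    simp only [star_smul, smul_mul_smul_comm, hz, one_smul, F.star_S_mul_S]
  range_le e := by
    have hz : (z : ℂ) * star (z : ℂ) = 1 := by
      simpa using Complex.mul_conj (z : ℂ)
    simp only [star_smul, smul_mul_smul_comm, hz, one_smul, F.range_le]
  sum_range x _ _ := by
    have hz : (z : ℂ) * star (z : ℂ) = 1 := by
      simpa using Complex.mul_conj (z : ℂ)
    simp only [star_smul, smul_mul_smul_comm, hz, one_smul]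
    exact F.sum_range x

end Family

/-- A representation of the graph: a C*-algebra with a family satisfying the relations. -/
structure Rep (V : Type u) [Quiver.{v} V] where
  B : Type (max u v)
  [inst : NonUnitalCStarAlgebra B]
  fam : Family V B

attribute [instance] Rep.inst

/-- The bounded product (`ℓ^∞`-direct product) of all the representations. -/
abbrev BigProd (V : Type u) [Quiver.{v} V] : Type _ := lp (fun F : Rep V => F.B) ∞

variable (V : Type u) [Quiver.{v} V]

/-- The element of the product that is `P_x` in every representation. -/
def bigP (x : V) : BigProd V :=
  ⟨fun F => F.fam.P x, memℓp_infty ⟨1, by rintro _ ⟨F, rfl⟩; exact F.fam.norm_P_le x⟩⟩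

/-- The element of the product that is `S_e` in every representation. -/
def bigS (e : Quiver.Total V) : BigProd V :=
  ⟨fun F => F.fam.S e, memℓp_infty ⟨1, by rintro _ ⟨F, rfl⟩; exact F.fam.norm_S_le e⟩⟩

/-- The C*-subalgebra of the product generated by the universal `P_x` and `S_e`. -/
def universalSubalgebra : NonUnitalStarSubalgebra ℂ (BigProd V) :=
  (NonUnitalStarAlgebra.adjoin ℂ (Set.range (bigP V) ∪ Set.range (bigS V))).topologicalClosure

instance : IsClosed (universalSubalgebra V : Set (BigProd V)) :=
  NonUnitalStarSubalgebra.isClosed_topologicalClosure _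

/-- The graph C*-algebra `C*(E)`: the universal C*-algebra generated by elements `P_x`, `S_e`
subject to the relations in `Family`. Its universal property is `existsUnique_lift` below. (The
C*-algebra generated by a family has at most `max (#V, #E, 2) ^ ℵ₀` elements, so up to isomorphism
it lives in `Type (max u v)` and the representations in `Rep V` exhaust all families.) -/
def CStar : Type _ := universalSubalgebra V

instance : NonUnitalCStarAlgebra (CStar V) :=
  inferInstanceAs (NonUnitalCStarAlgebra (universalSubalgebra V))

variable {V}

/-- The vertex projection `P_x` in `C*(E)`. -/
def genP (x : V) : CStar V :=
  ⟨bigP V x, NonUnitalStarSubalgebra.le_topologicalClosure _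
    (NonUnitalStarAlgebra.subset_adjoin ℂ _ (Or.inl ⟨x, rfl⟩))⟩

/-- The edge partial isometry `S_e` in `C*(E)`. -/
def genS (e : Quiver.Total V) : CStar V :=
  ⟨bigS V e, NonUnitalStarSubalgebra.le_topologicalClosure _
    (NonUnitalStarAlgebra.subset_adjoin ℂ _ (Or.inr ⟨e, rfl⟩))⟩

/-- Evaluation of an element of `C*(E)` in a representation. -/
def eval (F : Rep V) : CStar V →⋆ₙₐ[ℂ] F.B where
  toFun a := a.1 F
  map_smul' _ _ := rfl
  map_zero' := rfl
  map_add' _ _ := rfl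
  map_mul' _ _ := rfl
  map_star' _ := rfl

@[simp] lemma eval_genP (F : Rep V) (x : V) : eval F (genP x) = F.fam.P x := rfl

@[simp] lemma eval_genS (F : Rep V) (e : Quiver.Total V) : eval F (genS e) = F.fam.S e := rfl

lemma ext_eval {a b : CStar V} (h : ∀ F : Rep V, eval F a = eval F b) : a = b :=
  Subtype.ext (lp.ext (funext h))

/-- The generators of `C*(E)` satisfy the relations. -/
def universalFamily : Family V (CStar V) where
  P := genP
  S := genS
  proj x := ⟨ext_eval fun F => by
      simpa using (F.fam.proj x).isIdempotentElem.eq,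
    ext_eval fun F => by simpa [map_star] using (F.fam.proj x).isSelfAdjoint.star_eq⟩
  orth x y h := ext_eval fun F => by simpa using F.fam.orth x y h
  partial_isometry e := ext_eval fun F => by simpa [map_star] using F.fam.partial_isometry e
  range_orth e f h := ext_eval fun F => by simpa [map_star] using F.fam.range_orth e f h
  star_S_mul_S e := ext_eval fun F => by simpa [map_star] using F.fam.star_S_mul_S e
  range_le e := ext_eval fun F => by simpa [map_star] using F.fam.range_le e
  sum_range x _ _ := ext_eval fun F => by simpa [map_star, map_sum] using F.fam.sum_range x

/-- `C*(E)` is generated by the `P_x` and the `S_e` as a C*-algebra. -/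
lemma closure_induction {p : CStar V → Prop}
    (hP : ∀ x, p (genP x)) (hS : ∀ e, p (genS e))
    (zero : p 0) (add : ∀ a b, p a → p b → p (a + b)) (mul : ∀ a b, p a → p b → p (a * b))
    (smul : ∀ (c : ℂ) a, p a → p (c • a)) (star : ∀ a, p a → p (star a))
    (closed : IsClosed {a | p a}) (a : CStar V) : p a := by
  let A₀ := NonUnitalStarAlgebra.adjoin ℂ (Set.range (bigP V) ∪ Set.range (bigS V))
  have key : ∀ b (hb : b ∈ A₀),
      p ⟨b, NonUnitalStarSubalgebra.le_topologicalClosure _ hb⟩ := by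
    intro b hb
    induction hb using NonUnitalStarAlgebra.adjoin_induction with
    | mem x hx =>
      rcases hx with ⟨x, rfl⟩ | ⟨e, rfl⟩
      · exact hP x
      · exact hS e
    | zero => exact zero
    | add x y hx hy h1 h2 => exact add _ _ h1 h2
    | mul x y hx hy h1 h2 => exact mul _ _ h1 h2
    | smul c x hx h => exact smul c _ h
    | star x hx h => exact star _ h
  have ha : a ∈ closure {b : CStar V | b.1 ∈ A₀} := by
    have hmem : (a.1 : BigProd V) ∈ closure (A₀ : Set (BigProd V)) := a.2
    rw [Metric.mem_closure_iff] at hmem ⊢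
    intro ε hε
    obtain ⟨b, hb, hab⟩ := hmem ε hε
    exact ⟨⟨b, NonUnitalStarSubalgebra.le_topologicalClosure _ hb⟩, hb, hab⟩
  exact closure_minimal (fun b hb => key b.1 hb) closed ha

lemma hom_ext {D : Type*} [NonUnitalCStarAlgebra D] {φ ψ : CStar V →⋆ₙₐ[ℂ] D}
    (hP : ∀ x, φ (genP x) = ψ (genP x)) (hS : ∀ e, φ (genS e) = ψ (genS e)) : φ = ψ := by
  ext a
  refine closure_induction (p := fun a => φ a = ψ a) hP hS (by simp) ?_ ?_ ?_ ?_ ?_ a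
  · intro a b ha hb; simp [ha, hb]
  · intro a b ha hb; simp [ha, hb]
  · intro c a ha; simp [ha]
  · intro a ha; simp [map_star, ha]
  · exact isClosed_eq (continuous_hom φ) (continuous_hom ψ)

/-- The universal property of `C*(E)`. -/
theorem existsUnique_lift {B : Type (max u v)} [NonUnitalCStarAlgebra B] (F : Family V B) :
    ∃! φ : CStar V →⋆ₙₐ[ℂ] B, (∀ x, φ (genP x) = F.P x) ∧ ∀ e, φ (genS e) = F.S e := by
  refine ⟨eval ⟨B, F⟩, ⟨fun _ => rfl, fun _ => rfl⟩, ?_⟩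
  rintro ψ ⟨hP, hS⟩
  exact hom_ext (fun x => by rw [hP]; rfl) (fun e => by rw [hS]; rfl)

/-! ### The unit of the C*-algebra of a graph with finitely many vertices -/

section Unital

variable [Fintype V]

lemma sum_genP_mul (a : CStar V) : (∑ x : V, genP x) * a = a := by
  classical
  have hS : ∀ e, (∑ x : V, genP x) * (genS e : CStar V) = genS e := by
    intro e
    have h1 : (genP e.left : CStar V) * genS e = genS e := by
      have h := (universalFamily (V := V)).range_le e
      have h2 := (universalFamily (V := V)).partial_isometry e
      change genP e.left * (genS e * star (genS e)) = genS e * star (genS e) at h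
      change genS e * star (genS e) * genS e = genS e at h2
      calc genP e.left * genS e = genP e.left * (genS e * star (genS e)) * genS e := by
            rw [mul_assoc, h2]
        _ = genS e := by rw [h, h2]
    rw [Finset.sum_mul, Finset.sum_eq_single e.left _ (by simp), h1]
    intro x _ hx
    have h0 : (genP x : CStar V) * genP e.left = 0 := universalFamily.orth x e.left hx
    rw [← h1, ← mul_assoc, h0, zero_mul]
  have hS' : ∀ e, (∑ x : V, genP x) * star (genS e : CStar V) = star (genS e) := by
    intro e
    have h1 : (genP e.right : CStar V) * star (genS e) = star (genS e) := by
      have h2 := congrArg star ((universalFamily (V := V)).partial_isometry e)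
      have h := (universalFamily (V := V)).star_S_mul_S e
      change star (genS e) * genS e = genP e.right at h
      change star (genS e * star (genS e) * genS e) = star (genS e) at h2
      rw [star_mul, star_mul, star_star, ← mul_assoc, h] at h2
      exact h2
    rw [Finset.sum_mul, Finset.sum_eq_single e.right _ (by simp), h1]
    intro x _ hx
    have h0 : (genP x : CStar V) * genP e.right = 0 := universalFamily.orth x e.right hx
    rw [← h1, ← mul_assoc, h0, zero_mul]
  have hP : ∀ y, (∑ x : V, genP x) * (genP y : CStar V) = genP y := by
    intro y
    rw [Finset.sum_mul, Finset.sum_eq_single y _ (by simp)]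
    · exact ((universalFamily (V := V)).proj y).isIdempotentElem
    · intro x _ hx
      exact (universalFamily (V := V)).orth x y hx
  have hp : star (∑ x : V, (genP x : CStar V)) = ∑ x : V, genP x := by
    rw [star_sum]
    exact Finset.sum_congr rfl fun x _ => ((universalFamily (V := V)).proj x).isSelfAdjoint
  have main : (∑ x : V, genP x) * a = a ∧ (∑ x : V, genP x) * star a = star a := by
    refine closure_induction (p := fun a => (∑ x : V, genP x) * a = a ∧
      (∑ x : V, genP x) * star a = star a) ?_ ?_ ?_ ?_ ?_ ?_ ?_ ?_ a
    · intro y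
      refine ⟨hP y, ?_⟩
      have : star (genP y : CStar V) = genP y :=
        ((universalFamily (V := V)).proj y).isSelfAdjoint
      rw [this, hP y]
    · exact fun e => ⟨hS e, hS' e⟩
    · simp
    · intro a b ha hb
      rw [star_add, mul_add, mul_add, ha.1, ha.2, hb.1, hb.2]
      exact ⟨rfl, rfl⟩
    · intro a b ha hb
      rw [star_mul, ← mul_assoc, ← mul_assoc, ha.1, hb.2]
      exact ⟨rfl, rfl⟩
    · intro c a ha
      rw [star_smul, mul_smul_comm, mul_smul_comm, ha.1, ha.2]
      exact ⟨rfl, rfl⟩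
    · intro a ha
      rw [star_star]
      exact ⟨ha.2, ha.1⟩
    · exact (isClosed_eq (by fun_prop) (by fun_prop)).inter
        (isClosed_eq (by fun_prop) (by fun_prop))
  exact main.1

lemma mul_sum_genP (a : CStar V) : a * (∑ x : V, genP x) = a := by
  have hp : star (∑ x : V, (genP x : CStar V)) = ∑ x : V, genP x := by
    rw [star_sum]
    exact Finset.sum_congr rfl fun x _ => ((universalFamily (V := V)).proj x).isSelfAdjoint
  have h := congrArg star (sum_genP_mul (star a))
  rwa [star_mul, star_star, hp] at h

/-- If the graph has finitely many vertices, then `C*(E)` is unital, with unit `∑ x, P_x`. -/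
instance instCStarAlgebra : CStarAlgebra (CStar V) :=
  let R : NormedRing (CStar V) :=
    { (inferInstance : NonUnitalNormedRing (CStar V)) with
      one := ∑ x : V, genP x
      one_mul := sum_genP_mul
      mul_one := mul_sum_genP }
  let Al : Algebra ℂ (CStar V) :=
    Algebra.ofModule (fun r x y => smul_mul_assoc r x y) (fun r x y => mul_smul_comm r x y)
  { R, (inferInstance : NonUnitalCStarAlgebra (CStar V)) with
    toAlgebra := Al
    norm_smul_le := fun r x => norm_smul_le r x }

lemma one_def : (1 : CStar V) = ∑ x : V, genP x := rfl

end Unital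

/-! ### Actions of compact groups on C*-algebras -/

/-- A (point-norm continuous) action of a topological group on a C*-algebra by
`*`-automorphisms. -/
structure Action (G : Type*) [Group G] [TopologicalSpace G] (A : Type*)
    [NonUnitalCStarAlgebra A] where
  hom : G →* (A ≃⋆ₐ[ℂ] A)
  continuous_apply : ∀ a : A, Continuous fun g => hom g a

namespace Action

variable {G : Type*} [Group G] [TopologicalSpace G]

/-- The restriction of an action to a subgroup. -/
def restrict {A : Type*} [NonUnitalCStarAlgebra A] (α : Action G A) (H : Subgroup G) :
    Action H A where
  hom := α.hom.comp H.subtype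
  continuous_apply a := (α.continuous_apply a).comp continuous_subtype_val

/-- Freeness of an action of a compact group `G` on a C*-algebra `A` in the sense of Ellwood: the
linear span of the functions `g ↦ a * α_g(b)`, with `a` and `b` in `A`, is norm dense in
`A ⊗ C(G) = C(G, A)`. -/
def IsFree {A : Type*} [NonUnitalCStarAlgebra A] [CompactSpace G] (α : Action G A) : Prop :=
  Dense (Submodule.span ℂ {f : C(G, A) | ∃ a b : A, ∀ g, f g = a * α.hom g b} : Set C(G, A))

end Action

/-! ### The weak local-triviality dimension -/

/-- The C*-algebra `C_0((0,1]) ⊗ C(G)`, realised as `C_0((0,1] × G)`. -/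
abbrev Cone (G : Type*) [TopologicalSpace G] : Type _ := C₀(Set.Ioc (0 : ℝ) 1 × G, ℂ)

/-- The action of `G` on `C_0((0,1]) ⊗ C(G)` by translation in the second factor:
`(g • f)(s, h) = f(s, h g)`. -/
def coneTranslate {G : Type*} [Group G] [TopologicalSpace G] [IsTopologicalGroup G] (g : G)
    (f : Cone G) : Cone G :=
  f.comp ((Homeomorph.refl (Set.Ioc (0 : ℝ) 1)).prodCongr (Homeomorph.mulRight g)).toCocompactMap

lemma coneTranslate_apply {G : Type*} [Group G] [TopologicalSpace G] [IsTopologicalGroup G] (g : G)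
    (f : Cone G) (s : Set.Ioc (0 : ℝ) 1) (h : G) : coneTranslate g f (s, h) = f (s, h * g) := rfl

/-- The element `t ⊗ 1` of `C_0((0,1]) ⊗ C(G)`, i.e. the function `(s, h) ↦ s`. -/
def coneT (G : Type*) [TopologicalSpace G] [CompactSpace G] : Cone G where
  toFun x := ((x.1 : ℝ) : ℂ)
  continuous_toFun := by fun_prop
  zero_at_infty' := by
    rw [Metric.tendsto_nhds]
    intro ε hε
    rw [Filter.eventually_iff, Filter.mem_cocompact]
    have hK : IsCompact (((↑) : Set.Ioc (0 : ℝ) 1 → ℝ) ⁻¹' Set.Icc ε 1) := by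
      rw [Topology.IsInducing.subtypeVal.isCompact_preimage_iff]
      · exact isCompact_Icc
      · intro x hx
        simpa using ⟨hε.trans_le hx.1, hx.2⟩
    refine ⟨_, hK.prod isCompact_univ, ?_⟩
    rintro ⟨s, h⟩ hs
    simp only [Set.mem_compl_iff, Set.mem_prod, Set.mem_preimage, Set.mem_Icc, Set.mem_univ,
      and_true, not_and, not_le] at hs
    have h1 : (s : ℝ) < ε := by
      by_contra hcon
      exact absurd s.2.2 (not_le.mpr (hs (not_lt.mp hcon)))
    simpa [abs_of_pos s.2.1] using h1

/-- There are `G`-equivariant `*`-homomorphisms `ρ_0, …, ρ_n : C_0((0,1]) ⊗ C(G) → A` such that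
`∑ ρ_i(t ⊗ 1)` is invertible. -/
def HasWeakTrivialization {G : Type*} [Group G] [TopologicalSpace G] [IsTopologicalGroup G]
    [CompactSpace G] {A : Type*} [CStarAlgebra A] (α : Action G A) (n : ℕ) : Prop :=
  ∃ ρ : Fin (n + 1) → (Cone G →⋆ₙₐ[ℂ] A),
    (∀ i g f, ρ i (coneTranslate g f) = α.hom g (ρ i f)) ∧ IsUnit (∑ i, ρ i (coneT G))

/-- The weak local-triviality dimension of an action of a compact group on a unital C*-algebra: the
smallest `n` as in `HasWeakTrivialization`, and `∞` if there is none. -/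
def weakLocalTrivDim {G : Type*} [Group G] [TopologicalSpace G] [IsTopologicalGroup G]
    [CompactSpace G] {A : Type*} [CStarAlgebra A] (α : Action G A) : ℕ∞ :=
  sInf {d : ℕ∞ | ∃ n : ℕ, d = n ∧ HasWeakTrivialization α n}

/-! ### The gauge action -/

/-- For `z` in the circle, the map on the product of all representations that evaluates at the
representation twisted by `z`. -/
def twistBig (z : Circle) : BigProd V →⋆ₙₐ[ℂ] BigProd V where
  toFun a := ⟨fun F => a ⟨F.B, F.fam.twist z⟩, memℓp_infty ⟨‖a‖, by
    rintro _ ⟨F, rfl⟩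
    exact lp.norm_apply_le_norm ENNReal.top_ne_zero a ⟨F.B, F.fam.twist z⟩⟩⟩
  map_smul' _ _ := rfl
  map_zero' := rfl
  map_add' _ _ := rfl
  map_mul' _ _ := rfl
  map_star' _ := rfl

lemma twistBig_mem (z : Circle) (a : BigProd V) (ha : a ∈ universalSubalgebra V) :
    twistBig z a ∈ universalSubalgebra V := by
  have hle : universalSubalgebra V ≤ (universalSubalgebra V).comap (twistBig z) := by
    refine NonUnitalStarSubalgebra.topologicalClosure_minimal _ ?_ ?_
    · refine NonUnitalStarAlgebra.adjoin_le ?_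
      rintro _ (⟨x, rfl⟩ | ⟨e, rfl⟩)
      · exact (genP x : CStar V).2
      · have : twistBig z (bigS V e) = (z : ℂ) • bigS V e := rfl
        change twistBig z (bigS V e) ∈ universalSubalgebra V
        rw [this]
        exact SMulMemClass.smul_mem _ (genS e : CStar V).2
    · exact IsClosed.preimage (continuous_hom (twistBig (V := V) z))
        (NonUnitalStarSubalgebra.isClosed_topologicalClosure _)
  exact hle ha

/-- The endomorphism of `C*(E)` with `P_x ↦ P_x` and `S_e ↦ z S_e`. -/
def gaugeHom (z : Circle) : CStar V →⋆ₙₐ[ℂ] CStar V where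
  toFun a := ⟨twistBig z a.1, twistBig_mem z a.1 a.2⟩
  map_smul' _ _ := rfl
  map_zero' := rfl
  map_add' _ _ := rfl
  map_mul' _ _ := rfl
  map_star' _ := rfl

@[simp] lemma gaugeHom_genP (z : Circle) (x : V) : gaugeHom z (genP x) = genP x := rfl

@[simp] lemma gaugeHom_genS (z : Circle) (e : Quiver.Total V) :
    gaugeHom z (genS e) = (z : ℂ) • genS e := rfl

lemma gaugeHom_mul (z w : Circle) (a : CStar V) :
    gaugeHom (z * w) a = gaugeHom z (gaugeHom w a) := by
  have h : gaugeHom (z * w) = (gaugeHom z).comp (gaugeHom (V := V) w) := by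
    refine hom_ext (fun x => by simp) (fun e => ?_)
    simp [smul_smul, mul_comm]
  exact DFunLike.congr_fun h a

lemma gaugeHom_one (a : CStar V) : gaugeHom 1 a = a := by
  have h : gaugeHom 1 = NonUnitalStarAlgHom.id ℂ (CStar V) :=
    hom_ext (fun x => by simp) (fun e => by simp)
  exact DFunLike.congr_fun h a

/-- The gauge automorphism of `C*(E)` with `P_x ↦ P_x` and `S_e ↦ z S_e`. -/
def gaugeEquiv (z : Circle) : CStar V ≃⋆ₐ[ℂ] CStar V where
  toFun := gaugeHom z
  invFun := gaugeHom z⁻¹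
  left_inv a := by rw [← gaugeHom_mul, inv_mul_cancel, gaugeHom_one]
  right_inv a := by rw [← gaugeHom_mul, mul_inv_cancel, gaugeHom_one]
  map_mul' := map_mul _
  map_add' := map_add _
  map_star' := map_star _
  map_smul' c a := map_smul _ c a

lemma continuous_gaugeHom (a : CStar V) : Continuous fun z : Circle => gaugeHom z a := by
  refine closure_induction (p := fun a => Continuous fun z : Circle => gaugeHom z a)
    ?_ ?_ ?_ ?_ ?_ ?_ ?_ ?_ a
  · intro x; simpa using continuous_const
  · intro e
    simp only [gaugeHom_genS]
    exact (continuous_subtype_val (p := fun z : ℂ => z ∈ Submonoid.unitSphere ℂ)).smul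
      continuous_const
  · simpa using continuous_const
  · intro a b ha hb; simpa only [map_add] using! ha.add hb
  · intro a b ha hb; simpa only [map_mul] using! ha.mul hb
  · intro c a ha; simpa only [map_smul] using! ha.const_smul c
  · intro a ha; simpa [map_star] using ha.star
  · rw [← isSeqClosed_iff_isClosed]
    intro s a hs hlim
    have hu : TendstoUniformly (fun n (z : Circle) => gaugeHom z (s n)) (fun z => gaugeHom z a)
        Filter.atTop := by
      rw [Metric.tendstoUniformly_iff]
      intro ε hε
      filter_upwards [(Metric.tendsto_nhds.mp hlim) ε hε] with n hn z
      rw [dist_comm, dist_eq_norm, ← map_sub]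
      exact (NonUnitalStarAlgHom.norm_apply_le _ _).trans_lt (by rwa [← dist_eq_norm])
    exact hu.continuous (Filter.Frequently.of_forall hs)

variable (V)

/-- The gauge action of the circle on `C*(E)`. -/
def gaugeAction : Action Circle (CStar V) where
  hom :=
    { toFun := gaugeEquiv
      map_one' := StarAlgEquiv.ext gaugeHom_one
      map_mul' := fun z w => StarAlgEquiv.ext (gaugeHom_mul z w) }
  continuous_apply := continuous_gaugeHom

/-- The copy `{z | z ^ k = 1}` of `ℤ/k` in the circle. -/
def cyclic (k : ℕ) : Subgroup Circle := (powMonoidHom k : Circle →* Circle).ker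

lemma mem_cyclic {k : ℕ} {z : Circle} : z ∈ cyclic k ↔ z ^ k = 1 := Iff.rfl

instance (k : ℕ) : CompactSpace (cyclic k) := by
  refine isCompact_iff_compactSpace.mp (IsClosed.isCompact ?_)
  exact isClosed_eq (f := fun z : Circle => z ^ k) (g := fun _ => 1) (by fun_prop) (by fun_prop)

/-- The gauge action of `ℤ/k` on `C*(E)`: the restriction of the gauge action of the circle. -/
def cyclicGaugeAction (k : ℕ) : Action (cyclic k) (CStar V) := (gaugeAction V).restrict (cyclic k)

end GraphCStar

end

noncomputable section

/-! The implications run (c) → (b) → (a) → (c).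

(c) → (b): products `S_p` along paths `p` ending at a sink `y` have gauge degree equal to the length
of `p`, initial projection `P_y`, and orthogonal ranges when their lengths differ. One such path for
each residue modulo `k` gives `X_0, …, X_{k-1}`. With `T = ∑ X_i`, the translates of the projection
`k⁻¹ T T*` are mutually orthogonal, and their sum `∑ X_i X_i*` is the image of `t ⊗ 1` under an
equivariant map on the cone (`sum_mul_star_mem_coneValues`). A path of length `k - 1` ending at `y`
supplies all residues through its final segments, and any one residue may instead be represented by
a prescribed path. By acyclicity, `1` is a sum of projections `S_p S_p*` with `p` ending at a sink
(`Family.P_mem_closure`), so a finite sum of these images dominates `1` and is invertible.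

(b) → (a): a partition of `t ⊗ 1` over the group, with square roots in `s`, turns invertibility of
`∑ ρ_i(t ⊗ 1)` into an exact formula for functions supported at one group element.

(a) → (c): if every path ending at the sink `y` has length less than `k - 1`, the left ideal `C*(E)
P_y`, spanned by the `S_p`, has no component of degree `-1` modulo `k`. Freeness would force this
component of the function `z ↦ z̄ P_y` to vanish, so `P_y = 0`; the representation on paths ending
at `y` excludes that. -/

namespace GraphCStar

/-! ### Actions of finite groups -/

section FiniteGroup

variable {G : Type*} [TopologicalSpace G]

/-- The function `(s, x) ↦ √s` for `x = g` and `0` otherwise. -/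
def coneSqrt [DiscreteTopology G] [CompactSpace G] (g : G) : Cone G where
  toFun x := by
    classical exact if x.2 = g then ((√(x.1 : ℝ) : ℝ) : ℂ) else 0
  continuous_toFun := by
    classical
    have h : Continuous fun x : G => if x = g then (1 : ℂ) else 0 := continuous_of_discreteTopology
    have h' : Continuous fun x : Set.Ioc (0 : ℝ) 1 × G =>
        ((√(x.1 : ℝ) : ℝ) : ℂ) * (if x.2 = g then (1 : ℂ) else 0) :=
      (by fun_prop : Continuous fun x : Set.Ioc (0 : ℝ) 1 × G => ((√(x.1 : ℝ) : ℝ) : ℂ)).mul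
        (h.comp continuous_snd)
    simpa using h'
  zero_at_infty' := by
    classical
    have h : Filter.Tendsto (fun x : Set.Ioc (0 : ℝ) 1 × G => √((coneT G x).re))
        (Filter.cocompact _) (nhds 0) := by
      have := (Complex.continuous_re.sqrt.tendsto 0).comp (coneT G).zero_at_infty'
      simpa using! this
    refine squeeze_zero_norm (fun x => ?_) h
    have hx : (coneT G x).re = x.1 := by simp [coneT]
    rw [hx]
    split_ifs
    · simp [abs_of_nonneg (Real.sqrt_nonneg _)]
    · simp

open Classical in
lemma coneSqrt_apply [DiscreteTopology G] [CompactSpace G] (g : G) (s : Set.Ioc (0 : ℝ) 1) (x : G) :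
    coneSqrt g (s, x) = if x = g then ((√(s : ℝ) : ℝ) : ℂ) else 0 := by
  change (if x = g then _ else _) = _
  congr

open Classical in
/-- The function on a discrete group that is `a` at `h` and `0` elsewhere. -/
def bump [DiscreteTopology G] {A : Type*} [NonUnitalCStarAlgebra A] (h : G) (a : A) : C(G, A) :=
  ⟨fun x => if x = h then a else 0, continuous_of_discreteTopology⟩

open Classical in
lemma bump_apply [DiscreteTopology G] {A : Type*} [NonUnitalCStarAlgebra A] (h x : G) (a : A) :
    bump h a x = if x = h then a else 0 := rfl

variable [Group G]

/-- At a point `(s, y)` only `g = y` contributes, and then the second factor is nonzero only for `x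
= h`, where the product is `√s √s = s`. This writes a function of `x` concentrated at `h` in the
shape `∑ b * α_x(c)` that freeness asks for. -/
lemma sum_coneSqrt_mul [IsTopologicalGroup G] [DiscreteTopology G] [Fintype G] (h x : G) :
    ∑ g, coneSqrt g * coneTranslate x (coneSqrt (g * h)) = (by
      classical exact if x = h then coneT G else 0) := by
  classical
  ext ⟨s, y⟩
  have h1 : (∑ g, coneSqrt g * coneTranslate x (coneSqrt (g * h))) (s, y) =
      ∑ g, coneSqrt g (s, y) * coneSqrt (g * h) (s, y * x) := by
    let ev : Cone G →+ ℂ := ⟨⟨fun f => f (s, y), rfl⟩, fun _ _ => rfl⟩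
    exact map_sum ev _ _
  rw [h1, Finset.sum_eq_single y]
  · have hs : ((√(s : ℝ) : ℝ) : ℂ) * ((√(s : ℝ) : ℝ) : ℂ) = ((s : ℝ) : ℂ) := by
      rw [← Complex.ofReal_mul, Real.mul_self_sqrt s.2.1.le]
    by_cases hx : x = h
    · simp [coneSqrt_apply, hx, hs, coneT]
    · simp [coneSqrt_apply, hx]
  · intro g _ hg
    simp [coneSqrt_apply, hg.symm]
  · simp

/-- The span is not only dense but everything: it contains each `bump h (a * u)` with `u = ∑ ρ_i(t ⊗
1)`, and since `u` is invertible these exhaust the functions on a finite group. -/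
theorem isFree_of_hasWeakTrivialization [IsTopologicalGroup G] [DiscreteTopology G] [Fintype G]
    {A : Type*} [CStarAlgebra A] {α : Action G A} {n : ℕ} (hα : HasWeakTrivialization α n) :
    α.IsFree := by
  classical
  obtain ⟨ρ, hρ, hu⟩ := hα
  set M := Submodule.span ℂ {f : C(G, A) | ∃ a b : A, ∀ g, f g = a * α.hom g b}
  have h1 : ∀ (h : G) (a : A), bump h (a * ∑ i, ρ i (coneT G)) ∈ M := by
    intro h a
    let F : Fin (n + 1) → G → C(G, A) := fun i g =>
      ⟨fun x => (a * ρ i (coneSqrt g)) * α.hom x (ρ i (coneSqrt (g * h))),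
        continuous_of_discreteTopology⟩
    have hF : bump h (a * ∑ i, ρ i (coneT G)) = ∑ i, ∑ g, F i g := by
      ext x
      simp only [bump_apply, ContinuousMap.coe_sum, Finset.sum_apply]
      have : ∀ i, ∑ g, F i g x = a * ρ i (if x = h then coneT G else 0) := by
        intro i
        have h2 : ∀ g, F i g x = a * ρ i (coneSqrt g * coneTranslate x (coneSqrt (g * h))) := by
          intro g
          rw [map_mul, hρ, ← mul_assoc]
          rfl
        simp only [h2, ← Finset.mul_sum, ← map_sum]
        rw [sum_coneSqrt_mul]
      simp only [this]
      split_ifs with hx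
      · rw [Finset.mul_sum]
      · simp
    rw [hF]
    exact M.sum_mem fun i _ => M.sum_mem fun g _ => Submodule.subset_span ⟨_, _, fun _ => rfl⟩
  have h2 : M = ⊤ := by
    refine eq_top_iff.mpr fun f _ => ?_
    have hf : f = ∑ h, bump h (f h) := by
      ext x
      simp [bump_apply]
    rw [hf]
    refine M.sum_mem fun h _ => ?_
    obtain ⟨w, hw⟩ := hu
    have := h1 h (f h * ↑w⁻¹)
    rwa [← hw, mul_assoc, Units.inv_mul, mul_one] at this
  change Dense (M : Set C(G, A))
  rw [h2]
  exact dense_univ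

/-- A projection whose translates by a finite group are mutually orthogonal defines an equivariant
`*`-homomorphism on the cone of the group. -/
theorem exists_cone_hom_of_orthogonal_translates [IsTopologicalGroup G] [Fintype G]
    {A : Type*} [NonUnitalCStarAlgebra A] (α : Action G A) [CompactSpace G] {q : A}
    (hq : IsStarProjection q) (horth : ∀ g, g ≠ 1 → q * α.hom g q = 0) :
    ∃ ρ : Cone G →⋆ₙₐ[ℂ] A, (∀ g f, ρ (coneTranslate g f) = α.hom g (ρ f)) ∧
      ρ (coneT G) = ∑ g, α.hom g q := by
  classical
  let I : Set.Ioc (0 : ℝ) 1 := ⟨1, by simp⟩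
  have hmul : ∀ g h : G, α.hom g⁻¹ q * α.hom h⁻¹ q = if g = h then α.hom g⁻¹ q else 0 := by
    intro g h
    have h1 : α.hom h⁻¹ q = α.hom g⁻¹ (α.hom (g * h⁻¹) q) := by
      rw [← StarAlgEquiv.mul_apply, ← map_mul, inv_mul_cancel_left]
    rw [h1, ← map_mul]
    split_ifs with hgh
    · subst hgh
      simp [hq.isIdempotentElem.eq]
    · rw [horth _ (by simpa [mul_inv_eq_one] using hgh), map_zero]
  -- Evaluate at `s = 1` and send the indicator of `h` to the translate of `q` by `h⁻¹`; the inverse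
  -- matches translation on the right in the cone.
  let ρ : Cone G →⋆ₙₐ[ℂ] A :=
    { toFun := fun f => ∑ h, f (I, h) • α.hom h⁻¹ q
      map_smul' := fun c f => by simp [Finset.smul_sum, smul_smul]
      map_zero' := by simp
      map_add' := fun f g => by simp [add_smul, Finset.sum_add_distrib]
      map_mul' := fun f g => by
        simp only [Finset.sum_mul_sum, smul_mul_smul_comm, hmul, smul_ite, smul_zero,
          Finset.sum_ite_eq, Finset.mem_univ, if_true]
        rfl
      map_star' := fun f => by
        have h (g : G) : star (α.hom g q) = α.hom g q := by
          rw [← map_star, hq.isSelfAdjoint.star_eq]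
        have h (g : G) : star (α.hom g⁻¹ q) = α.hom g⁻¹ q := h _
        simp only [star_sum, star_smul, h]
        rfl }
  refine ⟨ρ, fun g f => ?_, ?_⟩
  · change ∑ h, f (I, h * g) • α.hom h⁻¹ q = α.hom g (∑ h, f (I, h) • α.hom h⁻¹ q)
    rw [map_sum]
    refine Fintype.sum_equiv (Equiv.mulRight g) _ _ fun h => ?_
    rw [map_smul, ← StarAlgEquiv.mul_apply, ← map_mul]
    simp
  · change ∑ h, ((I : ℝ) : ℂ) • α.hom h⁻¹ q = _
    simp only [I, Complex.ofReal_one, one_smul]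
    exact Fintype.sum_equiv (Equiv.inv G) _ _ fun h => rfl

/-- The values at `t ⊗ 1` of the equivariant `*`-homomorphisms on the cone. -/
def coneValues [IsTopologicalGroup G] [CompactSpace G] {A : Type*} [NonUnitalCStarAlgebra A]
    (α : Action G A) : Set A :=
  {a | ∃ ρ : Cone G →⋆ₙₐ[ℂ] A, (∀ g f, ρ (coneTranslate g f) = α.hom g (ρ f)) ∧ ρ (coneT G) = a}

theorem hasWeakTrivialization_of_isUnit_sum [IsTopologicalGroup G] [CompactSpace G]
    {A : Type*} [CStarAlgebra A] (α : Action G A) (l : List A) (hl : ∀ a ∈ l, a ∈ coneValues α)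
    (hu : IsUnit l.sum) : HasWeakTrivialization α l.length := by
  -- `HasWeakTrivialization α n` asks for `n + 1` maps, so the zero map is prepended; this also
  -- covers the empty list.
  have h0 : (0 : A) ∈ coneValues α := ⟨0, fun g f => by simp, by simp⟩
  have hl' : ∀ i : Fin ((0 :: l).length), (0 :: l)[i] ∈ coneValues α := by
    intro i
    have := List.getElem_mem (l := 0 :: l) i.2
    rcases List.mem_cons.mp this with h | h
    · simpa [h] using h0
    · exact hl _ h
  choose ρ hρ hρt using hl'
  refine ⟨ρ, hρ, ?_⟩
  have : ∑ i, ρ i (coneT G) = (0 :: l).sum := by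
    rw [← Fin.sum_univ_getElem]
    exact Finset.sum_congr rfl fun i _ => hρt i
  change IsUnit (∑ i : Fin ((0 :: l).length), ρ i (coneT G))
  rw [this]
  simpa using hu

end FiniteGroup

/-! ### The group of roots of unity -/

section Cyclic

variable {k : ℕ}

lemma finite_cyclic (hk : k ≠ 0) : Finite (cyclic k) := by
  have h : {z : ℂ | z ^ k = 1}.Finite := by
    refine (Polynomial.nthRootsFinset k (1 : ℂ)).finite_toSet.subset fun z hz => ?_
    exact (Polynomial.mem_nthRootsFinset (Nat.pos_of_ne_zero hk) (1 : ℂ)).mpr hz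
  have := h.to_subtype
  refine Finite.of_injective (fun z : cyclic k => (⟨(z : Circle), ?_⟩ : {z : ℂ | z ^ k = 1})) ?_
  · have := mem_cyclic.mp z.2
    exact_mod_cast congrArg ((↑) : Circle → ℂ) this
  · intro z w h
    exact Subtype.ext (Circle.ext (Subtype.mk.inj h))

lemma coe_cyclic_pow (z : cyclic k) : ((z : Circle) : ℂ) ^ k = 1 := by
  exact_mod_cast congrArg ((↑) : Circle → ℂ) (mem_cyclic.mp z.2)

lemma coe_cyclic_pow_mod (z : cyclic k) (n : ℕ) :
    ((z : Circle) : ℂ) ^ (n % k) = ((z : Circle) : ℂ) ^ n := by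
  conv_rhs => rw [← Nat.mod_add_div n k, pow_add, pow_mul, coe_cyclic_pow, one_pow, mul_one]

/-- The power map is a character of the finite group, nontrivial because its value at the primitive
root `exp(2πi/k)` is not `1`. -/
lemma sum_cyclic_pow (hk : k ≠ 0) [Fintype (cyclic k)] {n : ℕ} (hn : ¬ k ∣ n) :
    ∑ z : cyclic k, ((z : Circle) : ℂ) ^ n = 0 := by
  let χ : cyclic k →* ℂ := (powMonoidHom n : ℂ →* ℂ).comp (Circle.coeHom.comp (cyclic k).subtype)
  refine sum_hom_units_eq_zero χ fun h => hn ?_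
  have hζ := Complex.isPrimitiveRoot_exp k hk
  have hc : ((Circle.exp (2 * Real.pi / k) : Circle) : ℂ) =
      Complex.exp (2 * Real.pi * Complex.I / k) := by
    rw [Circle.coe_exp]
    congr 1
    push_cast
    ring
  have hmem : Circle.exp (2 * Real.pi / k) ∈ cyclic k := by
    rw [mem_cyclic]
    refine Circle.ext ?_
    rw [Circle.coe_pow, hc, hζ.pow_eq_one, Circle.coe_one]
  have h1 : ((Circle.exp (2 * Real.pi / k) : Circle) : ℂ) ^ n = 1 := DFunLike.congr_fun h ⟨_, hmem⟩
  rw [hc] at h1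
  exact hζ.dvd_of_pow_eq_one n h1

lemma sum_pow_of_ne_one {z : cyclic k} (hz : z ≠ 1) :
    ∑ j : Fin k, ((z : Circle) : ℂ) ^ (j : ℕ) = 0 := by
  have hz' : ((z : Circle) : ℂ) - 1 ≠ 0 := by
    rw [sub_ne_zero]
    exact fun h => hz (Subtype.ext (Circle.ext (by simpa using h)))
  have h := geom_sum_mul ((z : Circle) : ℂ) k
  rw [coe_cyclic_pow, sub_self] at h
  rw [Fin.sum_univ_eq_sum_range (fun j => ((z : Circle) : ℂ) ^ j)]
  exact (mul_eq_zero.mp h).resolve_right hz'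

lemma card_cyclic (hk : k ≠ 0) [Fintype (cyclic k)] : (Fintype.card (cyclic k) : ℂ) = k := by
  have : NeZero k := ⟨hk⟩
  -- The double sum of `z ^ j` is counted in both orders: summing over `j` first leaves `z = 1`,
  -- summing over `z` first leaves `j = 0`.
  have h1 : ∑ z : cyclic k, ∑ j : Fin k, ((z : Circle) : ℂ) ^ (j : ℕ) = k := by
    rw [Finset.sum_eq_single 1 (fun z _ hz => sum_pow_of_ne_one hz) (by simp)]
    simp
  have h2 : ∑ j : Fin k, ∑ z : cyclic k, ((z : Circle) : ℂ) ^ (j : ℕ) =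
      Fintype.card (cyclic k) := by
    rw [Finset.sum_eq_single 0 _ (by simp)]
    · simp
    · intro j _ hj
      refine sum_cyclic_pow hk fun h => hj ?_
      exact Fin.ext (by simpa using Nat.eq_zero_of_dvd_of_lt h j.2)
  rw [← h2, Finset.sum_comm, h1]

lemma sum_cyclic_pow_mul_star (hk : k ≠ 0) [Fintype (cyclic k)] (i j : Fin k) :
    ∑ z : cyclic k, ((z : Circle) : ℂ) ^ (i : ℕ) * star (((z : Circle) : ℂ) ^ (j : ℕ)) =
      if i = j then (k : ℂ) else 0 := by
  have hs : ∀ z : cyclic k, star (((z : Circle) : ℂ) ^ (j : ℕ)) =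
      ((z : Circle) : ℂ) ^ (k - j : ℕ) := by
    intro z
    have h1 : ((z : Circle) : ℂ) ^ (j : ℕ) * star (((z : Circle) : ℂ) ^ (j : ℕ)) = 1 := by
      simp [Complex.mul_conj, ← mul_pow]
    have h2 : ((z : Circle) : ℂ) ^ (j : ℕ) * ((z : Circle) : ℂ) ^ (k - j : ℕ) = 1 := by
      rw [← pow_add, Nat.add_sub_cancel' j.2.le, coe_cyclic_pow]
    exact mul_left_cancel₀ (left_ne_zero_of_mul_eq_one h1) (h1.trans h2.symm)
  simp only [hs, ← pow_add]
  split_ifs with h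
  · subst h
    simp [Nat.add_sub_cancel' i.2.le, coe_cyclic_pow, card_cyclic hk]
  · refine sum_cyclic_pow hk fun hd => h ?_
    obtain ⟨c, hc⟩ := hd
    have hi := i.2
    have hj := j.2
    -- For `i, j < k` the exponent `i + (k - j)` lies strictly between `0` and `2k`, so divisibility
    -- by `k` forces it to be `k`.
    have : c = 1 := by
      have h1 : 0 < k * c := by omega
      have h2 : k * c < k * 2 := by omega
      have h3 := Nat.pos_of_mul_pos_left h1
      have h4 := Nat.lt_of_mul_lt_mul_left h2
      omega
    subst this
    exact Fin.ext (by omega)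

/-- A system of partial isometries of all degrees modulo `k`, with a common initial projection and
orthogonal to each other, gives an equivariant `*`-homomorphism on the cone. -/
theorem sum_mul_star_mem_coneValues (hk : k ≠ 0) {A : Type*} [NonUnitalCStarAlgebra A]
    (α : Action (cyclic k) A) {X : Fin k → A} {P : A}
    (horth : ∀ i j, star (X i) * X j = if i = j then P else 0) (hXP : ∀ i, X i * P = X i)
    (hα : ∀ z i, α.hom z (X i) = ((z : Circle) : ℂ) ^ (i : ℕ) • X i) :
    ∑ i, X i * star (X i) ∈ coneValues α := by
  have := finite_cyclic hk
  have := Fintype.ofFinite (cyclic k)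
  have hkC : (k : ℂ) ≠ 0 := by exact_mod_cast hk
  set T := ∑ i, X i with hT
  have hTP : T * P = T := by simp [hT, Finset.sum_mul, hXP]
  have hTT : star T * T = (k : ℂ) • P := by
    simp [hT, star_sum, Finset.sum_mul_sum, horth, Nat.cast_smul_eq_nsmul]
  -- Orthogonality of the `X_i` leaves `(∑ z ^ j) • P`, a vanishing geometric sum.
  have hTα : ∀ z, z ≠ 1 → star T * α.hom z T = 0 := by
    intro z hz
    simp only [hT, star_sum, map_sum, Finset.sum_mul_sum, hα, mul_smul_comm, horth, smul_ite,
      smul_zero, Finset.sum_ite_eq, Finset.mem_univ, if_true]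
    rw [← Finset.sum_smul, sum_pow_of_ne_one hz, zero_smul]
  have hq : IsStarProjection ((k : ℂ)⁻¹ • (T * star T)) := by
    constructor
    · change _ * _ = _
      rw [smul_mul_smul_comm, mul_assoc, ← mul_assoc (star T), hTT, smul_mul_assoc,
        mul_smul_comm, ← mul_assoc, hTP, smul_smul, mul_assoc, inv_mul_cancel₀ hkC, mul_one]
    · change star _ = _
      simp
  obtain ⟨ρ, hρ, hρt⟩ := exists_cone_hom_of_orthogonal_translates α hq fun z hz => by
    rw [map_smul, map_mul, smul_mul_smul_comm, mul_assoc, ← mul_assoc (star T), hTα z hz,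
      zero_mul, mul_zero, smul_zero]
  refine ⟨ρ, hρ, hρt.trans ?_⟩
  -- Summing over the group kills the cross terms `X_i X_j*` with `i ≠ j`, and each diagonal term
  -- gains a factor `k`.
  have h1 : ∀ z : cyclic k, α.hom z ((k : ℂ)⁻¹ • (T * star T)) = (k : ℂ)⁻¹ • ∑ i : Fin k, ∑ j : Fin k,
      (((z : Circle) : ℂ) ^ (i : ℕ) * star (((z : Circle) : ℂ) ^ (j : ℕ))) •
        (X i * star (X j)) := by
    intro z
    rw [map_smul, map_mul, map_star, hT, map_sum, star_sum, Finset.sum_mul_sum]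
    simp only [hα, star_smul, smul_mul_smul_comm]
  simp only [h1]
  rw [← Finset.smul_sum, Finset.sum_comm]
  simp only [Finset.sum_comm (s := (Finset.univ : Finset (cyclic k))), ← Finset.sum_smul,
    sum_cyclic_pow_mul_star hk, ite_smul, zero_smul, Finset.sum_ite_eq, Finset.mem_univ, if_true]
  rw [← Finset.smul_sum, smul_smul, inv_mul_cancel₀ hkC, one_smul]

end Cyclic

/-! ### Paths that end at a given vertex -/

variable {V : Type u} [Quiver.{v} V]

/-- The directed paths from a vertex `x` to `y`, built by prepending edges. -/
inductive PathTo (y : V) : V → Type (max u v)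
  | nil : PathTo y y
  | cons (e : Quiver.Total V) (p : PathTo y e.right) : PathTo y e.left

namespace PathTo

variable {y : V}

/-- The number of edges of a path. -/
def length : {x : V} → PathTo y x → ℕ
  | _, nil => 0
  | _, cons _ p => p.length + 1

/-- Dropping initial edges keeps the endpoint `y`, so final segments realise every smaller length.
-/
lemma exists_length_eq {x : V} (p : PathTo y x) {n : ℕ} (hn : n ≤ p.length) :
    ∃ (x' : V) (q : PathTo y x'), q.length = n := by
  induction p with
  | nil => exact ⟨y, nil, by simp [length] at hn ⊢; omega⟩
  | cons e p ih =>
    rcases Nat.lt_or_ge p.length n with h | h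
    · exact ⟨_, cons e p, by simp only [length] at hn ⊢; omega⟩
    · exact ih h

lemma exists_of_path {x x' : V} (p : Quiver.Path x x') (q : PathTo y x') :
    ∃ r : PathTo y x, r.length = p.length + q.length := by
  induction p with
  | nil => exact ⟨q, by simp⟩
  | cons p e ih =>
    obtain ⟨r, hr⟩ := ih (cons ⟨_, _, e⟩ q)
    exact ⟨r, by simp only [hr, length, Quiver.Path.length_cons]; omega⟩

lemma exists_path {x : V} (p : PathTo y x) : ∃ q : Quiver.Path x y, q.length = p.length := by
  induction p with
  | nil => exact ⟨Quiver.Path.nil, rfl⟩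
  | cons e p ih =>
    obtain ⟨q, hq⟩ := ih
    exact ⟨e.hom.toPath.comp q, by simp [hq, length, add_comm]⟩

end PathTo

/-- `Quiver.Path` grows at its end, whereas induction on `S_e * S_p` needs edges prepended; this
passes between the two kinds of path. -/
lemma exists_path_length_iff {y : V} {n : ℕ} :
    (∃ (x : V) (p : Quiver.Path x y), p.length = n) ↔
      ∃ (x : V) (p : PathTo y x), p.length = n := by
  constructor
  · rintro ⟨x, p, rfl⟩
    obtain ⟨r, hr⟩ := PathTo.exists_of_path p PathTo.nil
    exact ⟨x, r, hr⟩
  · rintro ⟨x, p, rfl⟩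
    obtain ⟨q, hq⟩ := p.exists_path
    exact ⟨x, q, hq⟩

theorem IsAcyclic.induction [Finite V] (hE : IsAcyclic V) {motive : V → Prop}
    (h : ∀ x, (∀ e : Quiver.Total V, e.left = x → motive e.right) → motive x) (x : V) :
    motive x := by
  -- `R x y` says that `x` is reached from `y` by a path of positive length; acyclicity is its
  -- irreflexivity, and finiteness makes it well founded.
  let R : V → V → Prop := fun x y => ∃ p : Quiver.Path y x, 0 < p.length
  have : IsTrans V R := ⟨fun a b c ⟨p, hp⟩ ⟨q, hq⟩ => ⟨q.comp p, by simp; omega⟩⟩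
  have : Std.Irrefl R := ⟨fun a ⟨p, hp⟩ => hp.ne' (hE a p)⟩
  refine (Finite.wellFounded_of_trans_of_irrefl R).induction x fun x ih => h x ?_
  rintro e rfl
  exact ih _ ⟨e.hom.toPath, by simp⟩

instance finite_total [Finite V] [∀ x y : V, Finite (x ⟶ y)] : Finite (Quiver.Total V) :=
  Finite.of_injective (fun e : Quiver.Total V => (⟨e.left, e.right, e.hom⟩ : Σ x y : V, (x ⟶ y)))
    (by rintro ⟨⟩ ⟨⟩ h; cases h; rfl)

theorem IsAcyclic.finite_pathTo [Finite V] [∀ x y : V, Finite (x ⟶ y)] (hE : IsAcyclic V)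
    (y x : V) : Finite (PathTo y x) := by
  refine hE.induction (motive := fun x => Finite (PathTo y x)) (fun x ih => ?_) x
  have : ∀ e : {e : Quiver.Total V // e.left = x}, Finite (PathTo y e.1.right) :=
    fun e => ih e.1 e.2
  let f : PLift (x = y) ⊕ (Σ e : {e : Quiver.Total V // e.left = x}, PathTo y e.1.right) →
      PathTo y x
    | .inl h => h.down ▸ .nil
    | .inr ⟨e, p⟩ => e.2 ▸ .cons e.1 p
  refine Finite.of_surjective f fun p => ?_
  cases p with
  | nil => exact ⟨.inl ⟨rfl⟩, rfl⟩
  | cons e p => exact ⟨.inr ⟨⟨e, rfl⟩, p⟩, rfl⟩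

/-! ### Products of generators along paths -/

namespace Family

variable {B : Type*} [NonUnitalCStarAlgebra B] (F : Family V B)

lemma S_mul_P (e : Quiver.Total V) : F.S e * F.P e.right = F.S e := by
  rw [← F.star_S_mul_S, ← mul_assoc, F.partial_isometry]

lemma P_mul_S (e : Quiver.Total V) : F.P e.left * F.S e = F.S e := by
  calc F.P e.left * F.S e = F.P e.left * (F.S e * star (F.S e)) * F.S e := by
        rw [mul_assoc, F.partial_isometry]
    _ = F.S e := by rw [F.range_le, F.partial_isometry]

lemma P_mul_P_self (x : V) : F.P x * F.P x = F.P x := (F.proj x).isIdempotentElem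

lemma star_P (x : V) : star (F.P x) = F.P x := (F.proj x).isSelfAdjoint

lemma P_mul_S_of_ne {x : V} {e : Quiver.Total V} (h : e.left ≠ x) : F.P x * F.S e = 0 := by
  rw [← F.P_mul_S, ← mul_assoc, F.orth _ _ h.symm, zero_mul]

lemma star_S_mul_S_of_ne {e f : Quiver.Total V} (h : e ≠ f) : star (F.S e) * F.S f = 0 := by
  have h1 : star (F.S e) * F.S f =
      star (F.S e) * ((F.S e * star (F.S e)) * (F.S f * star (F.S f))) * F.S f := by
    have h2 : star (F.S e) * (F.S e * star (F.S e)) = star (F.S e) := by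
      simpa [mul_assoc] using congrArg star (F.partial_isometry e)
    rw [← mul_assoc (star (F.S e)), h2, mul_assoc, F.partial_isometry]
  rw [h1, F.range_orth e f h, mul_zero, zero_mul]

variable {y : V}

/-- The product of the `S_e` along a path, which is `P_y` for the trivial path at `y`. -/
def pathS : {x : V} → PathTo y x → B
  | _, .nil => F.P y
  | _, .cons e p => F.S e * pathS p

lemma P_mul_pathS {x : V} (p : PathTo y x) : F.P x * F.pathS p = F.pathS p := by
  cases p with
  | nil => exact F.P_mul_P_self y
  | cons e p => rw [pathS, ← mul_assoc, F.P_mul_S]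

lemma pathS_mul_P {x : V} (p : PathTo y x) : F.pathS p * F.P y = F.pathS p := by
  induction p with
  | nil => exact F.P_mul_P_self y
  | cons e p ih => rw [pathS, mul_assoc, ih]

lemma P_mul_pathS_of_ne {x x' : V} (p : PathTo y x) (h : x' ≠ x) : F.P x' * F.pathS p = 0 := by
  rw [← F.P_mul_pathS, ← mul_assoc, F.orth _ _ h, zero_mul]

lemma star_pathS_mul_pathS_self {x : V} (p : PathTo y x) :
    star (F.pathS p) * F.pathS p = F.P y := by
  induction p with
  | nil => rw [pathS, F.star_P, F.P_mul_P_self]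
  | cons e p ih =>
    rw [pathS, star_mul, mul_assoc, ← mul_assoc (star (F.S e)), F.star_S_mul_S, P_mul_pathS, ih]

/-- Cancel common first edges. Either two different edges meet, whose ranges are orthogonal, or one
path becomes trivial at `y` while the other still starts with an edge, which `y`, being a sink, does
not emit. -/
lemma star_pathS_mul_pathS_of_length_ne (hy : IsSink y) {x x' : V} (p : PathTo y x)
    (q : PathTo y x') (h : p.length ≠ q.length) : star (F.pathS p) * F.pathS q = 0 := by
  induction p generalizing x' with
  | nil =>
    cases q with
    | nil => exact absurd rfl h
    | cons f q => rw [pathS, pathS, F.star_P, ← mul_assoc, F.P_mul_S_of_ne (hy f), zero_mul]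
  | cons e p ih =>
    cases q with
    | nil =>
      have h1 : star (F.S e) * F.P y = 0 := by
        simpa [F.star_P] using congrArg star (F.P_mul_S_of_ne (hy e))
      rw [pathS, pathS, star_mul, mul_assoc, h1, mul_zero]
    | cons f q =>
      rw [pathS, pathS, star_mul, mul_assoc, ← mul_assoc (star (F.S e))]
      by_cases hef : e = f
      · subst hef
        rw [F.star_S_mul_S, P_mul_pathS]
        exact ih q (by simpa [PathTo.length] using h)
      · rw [F.star_S_mul_S_of_ne hef, zero_mul, mul_zero]

end Family

/-! ### Finite weak local-triviality dimension -/

/-- In an acyclic finite graph, every vertex projection is a sum of range projections of paths that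
end at sinks. -/
theorem Family.P_mem_closure [Finite V] [∀ x y : V, Finite (x ⟶ y)] (hE : IsAcyclic V)
    {B : Type*} [NonUnitalCStarAlgebra B] (F : Family V B) (x : V) :
    F.P x ∈ AddSubmonoid.closure {b : B | ∃ (y x : V) (p : PathTo y x), IsSink y ∧
      b = F.pathS p * star (F.pathS p)} := by
  set D := AddSubmonoid.closure {b : B | ∃ (y x : V) (p : PathTo y x), IsSink y ∧
      b = F.pathS p * star (F.pathS p)}
  have hD : ∀ (e : Quiver.Total V), ∀ b ∈ D, F.S e * b * star (F.S e) ∈ D := by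
    intro e b hb
    induction hb using AddSubmonoid.closure_induction with
    | mem b hb =>
      obtain ⟨y, x, p, hy, rfl⟩ := hb
      by_cases hx : e.right = x
      · subst hx
        refine AddSubmonoid.subset_closure ⟨y, _, .cons e p, hy, ?_⟩
        simp [Family.pathS, mul_assoc]
      · rw [← F.S_mul_P, mul_assoc (F.S e), ← mul_assoc (F.P _), F.P_mul_pathS_of_ne p hx]
        simp
    | zero => simp
    | add a b _ _ ha hb =>
      rw [mul_add, add_mul]
      exact D.add_mem ha hb
  refine hE.induction (motive := fun x => F.P x ∈ D) (fun x ih => ?_) x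
  by_cases hx : IsSink x
  · refine AddSubmonoid.subset_closure ⟨x, x, .nil, hx, ?_⟩
    rw [Family.pathS, F.star_P, F.P_mul_P_self]
  · have : Nonempty {e : Quiver.Total V // e.left = x} := by
      simpa [IsSink, nonempty_subtype] using hx
    have := Fintype.ofFinite {e : Quiver.Total V // e.left = x}
    rw [F.sum_range x]
    refine D.sum_mem fun e _ => ?_
    -- Each summand is `S_e P_{r(e)} S_e*`, to which the induction hypothesis at `r(e)` applies.
    have := hD e.1 _ (ih e.1 e.2)
    rwa [F.S_mul_P] at this

lemma gaugeHom_pathS (z : Circle) {y x : V} (p : PathTo y x) :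
    gaugeHom z ((universalFamily (V := V)).pathS p) =
      (z : ℂ) ^ p.length • (universalFamily (V := V)).pathS p := by
  induction p with
  | nil => simp only [Family.pathS, PathTo.length, pow_zero, one_smul]; rfl
  | cons e p ih =>
    have : gaugeHom z ((universalFamily (V := V)).S e) = (z : ℂ) • universalFamily.S e := rfl
    rw [Family.pathS, map_mul, ih, this, smul_mul_smul_comm, PathTo.length, pow_succ']

theorem exists_hasWeakTrivialization [Fintype V] [∀ x y : V, Finite (x ⟶ y)] (hE : IsAcyclic V)
    {k : ℕ} (hk : k ≠ 0)
    (h : ∀ y : V, IsSink y → ∃ (x : V) (p : PathTo y x), p.length = k - 1) :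
    ∃ n, HasWeakTrivialization (cyclicGaugeAction V k) n := by
  let _ := CStarAlgebra.spectralOrder (CStar V)
  have := CStarAlgebra.spectralOrderedRing (CStar V)
  set F := universalFamily (V := V)
  have h1 : (1 : CStar V) ∈ AddSubmonoid.closure {b | ∃ (y x : V) (p : PathTo y x), IsSink y ∧
      b = F.pathS p * star (F.pathS p)} :=
    AddSubmonoid.sum_mem _ fun x _ => F.P_mem_closure hE x
  -- Being dominated by a sum of cone values is stable under addition, and an element above `1` is
  -- invertible.
  suffices ∀ b ∈ AddSubmonoid.closure {b | ∃ (y x : V) (p : PathTo y x), IsSink y ∧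
      b = F.pathS p * star (F.pathS p)}, ∃ l : List (CStar V),
      (∀ a ∈ l, a ∈ coneValues (cyclicGaugeAction V k)) ∧ b ≤ l.sum by
    obtain ⟨l, hl, h1⟩ := this 1 h1
    exact ⟨_, hasWeakTrivialization_of_isUnit_sum _ l hl (CStarAlgebra.isUnit_of_le 1 h1)⟩
  intro b hb
  induction hb using AddSubmonoid.closure_induction with
  | zero => exact ⟨[], by simp, by simp⟩
  | add a b _ _ ha hb =>
    obtain ⟨l, hl, h1⟩ := ha
    obtain ⟨m, hm, h2⟩ := hb
    refine ⟨l ++ m, fun a ha => ?_, by simpa using add_le_add h1 h2⟩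
    exact (List.mem_append.mp ha).elim (hl a) (hm a)
  | mem b hb =>
    obtain ⟨y, x, p, hy, rfl⟩ := hb
    obtain ⟨x', r, hr⟩ := h y hy
    let j₀ : Fin k := ⟨p.length % k, Nat.mod_lt _ (Nat.pos_of_ne_zero hk)⟩
    -- The residue of the length of `p` is represented by `p` itself, so that `S_p S_p*` is one of
    -- the summands; final segments of `r`, of lengths `0, …, k - 1`, serve the other residues.
    have hν : ∀ j : Fin k, ∃ ν : Σ x, PathTo y x, ν.2.length % k = j ∧ (j = j₀ → ν = ⟨x, p⟩) := by
      intro j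
      by_cases hj : j = j₀
      · exact ⟨⟨x, p⟩, by rw [hj], fun _ => rfl⟩
      · obtain ⟨x'', q, hq⟩ := r.exists_length_eq (n := j) (by have := j.2; omega)
        exact ⟨⟨x'', q⟩, by simp [hq, Nat.mod_eq_of_lt j.2], fun h => absurd h hj⟩
    choose ν hν hν₀ using hν
    have hmem := sum_mul_star_mem_coneValues hk (cyclicGaugeAction V k)
      (X := fun j => F.pathS (ν j).2) (P := F.P y)
      (fun i j => by
        split_ifs with hij
        · subst hij
          exact F.star_pathS_mul_pathS_self _
        · refine F.star_pathS_mul_pathS_of_length_ne hy _ _ fun hl => hij ?_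
          exact Fin.ext (by rw [← hν i, ← hν j, hl]))
      (fun i => F.pathS_mul_P _)
      (fun z i => by
        rw [← hν i, coe_cyclic_pow_mod]
        exact gaugeHom_pathS _ _)
    refine ⟨[_], by simpa using hmem, ?_⟩
    have h2 := Finset.single_le_sum (f := fun j => F.pathS (ν j).2 * star (F.pathS (ν j).2))
      (fun j _ => mul_star_self_nonneg _) (Finset.mem_univ j₀)
    rw [hν₀ j₀ rfl] at h2
    simpa using h2

/-! ### The representation on the paths that end at a sink -/

/-- The path `p` is obtained from the path `q` by prepending the edge `e`. -/
inductive IsCons {y : V} (e : Quiver.Total V) : (Σ x, PathTo y x) → (Σ x, PathTo y x) → Prop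
  | mk (p : PathTo y e.right) : IsCons e ⟨e.right, p⟩ ⟨e.left, .cons e p⟩

namespace IsCons

variable {y : V} {e f : Quiver.Total V} {p p' q q' : Σ x, PathTo y x}

lemma exists_iff : (∃ p, IsCons e q p) ↔ q.1 = e.right := by
  constructor
  · rintro ⟨_, ⟨p⟩⟩
    rfl
  · obtain ⟨x, q⟩ := q
    rintro rfl
    exact ⟨_, .mk q⟩

lemma fst_eq (h : IsCons e q p) : p.1 = e.left := by
  cases h
  rfl

lemma right_unique (h : IsCons e q p) (h' : IsCons e q p') : p = p' := by
  obtain ⟨x, q⟩ := q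
  cases h
  cases h'
  rfl

lemma eq_and_eq (h : IsCons e q p) (h' : IsCons f q' p) : e = f ∧ q = q' := by
  -- Reads off the first edge and the rest of a path, so that both can be compared at once.
  let f : (Σ x, PathTo y x) → Option (Σ e : Quiver.Total V, PathTo y e.right)
    | ⟨_, .nil⟩ => none
    | ⟨_, .cons e p⟩ => some ⟨e, p⟩
  have hf : ∀ {e q p}, IsCons e q p → ∃ r, f p = some ⟨e, r⟩ ∧ q = ⟨_, r⟩ := by
    rintro e _ _ ⟨r⟩
    exact ⟨r, rfl, rfl⟩
  obtain ⟨r, h1, rfl⟩ := hf h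
  obtain ⟨r', h2, rfl⟩ := hf h'
  cases h1.symm.trans h2
  exact ⟨rfl, rfl⟩

lemma exists_of_ne (h : p.1 ≠ y) : ∃ e q, IsCons e q p := by
  obtain ⟨x, p⟩ := p
  cases p with
  | nil => exact absurd rfl h
  | cons e p => exact ⟨e, _, .mk p⟩

end IsCons

section PathRep

open scoped ComplexOrder

open Classical in
/-- The family of 0-1 matrices on the set of paths that end at a sink. -/
def pathFamily {y : V} (hy : IsSink y) [Fintype (Σ x, PathTo y x)] :
    Family V (CStarMatrix (Σ x, PathTo y x) (Σ x, PathTo y x) ℂ) := by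
  -- `D R` is the diagonal projection onto the paths satisfying `R`. `S e` sends the basis vector of
  -- `q` to that of `q` with `e` prepended, or to `0` if they do not compose, so all relations
  -- become identities between projections `D R`.
  let D (R : (Σ x, PathTo y x) → Prop) : CStarMatrix (Σ x, PathTo y x) (Σ x, PathTo y x) ℂ :=
    CStarMatrix.ofMatrix fun p q => if p = q ∧ R p then 1 else 0
  let S (e : Quiver.Total V) : CStarMatrix (Σ x, PathTo y x) (Σ x, PathTo y x) ℂ :=
    CStarMatrix.ofMatrix fun p q => if IsCons e q p then 1 else 0
  have hDapp : ∀ R p q, D R p q = if p = q ∧ R p then 1 else 0 := fun _ _ _ => rfl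
  have hSapp : ∀ e p q, S e p q = if IsCons e q p then 1 else 0 := fun _ _ _ => rfl
  have hDD : ∀ R R', D R * D R' = D fun p => R p ∧ R' p := by
    intro R R'
    ext p q
    rw [CStarMatrix.mul_apply, Finset.sum_eq_single p]
    · simp only [hDapp]
      by_cases hR : R p <;> by_cases hR' : R' p <;> simp [hR, hR']
    · intro r _ hr
      simp [hDapp, hr.symm]
    · simp
  have hDstar : ∀ R, star (D R) = D R := by
    intro R
    ext p q
    rw [CStarMatrix.star_apply, hDapp, hDapp]
    by_cases hpq : p = q
    · subst hpq
      split_ifs <;> simp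
    · simp [hpq, Ne.symm hpq]
  have hD0 : ∀ R, (∀ p, ¬ R p) → D R = 0 := by
    intro R hR
    ext p q
    simp [hDapp, hR]
  have hSS : ∀ e, star (S e) * S e = D fun p => p.1 = e.right := by
    intro e
    ext q q'
    simp only [CStarMatrix.mul_apply, CStarMatrix.star_apply, hDapp, hSapp]
    by_cases hq : ∃ p, IsCons e q p
    · obtain ⟨p, hp⟩ := hq
      rw [Finset.sum_eq_single p]
      · have h1 : q.1 = e.right := IsCons.exists_iff.mp ⟨p, hp⟩
        by_cases hqq : q = q'
        · subst hqq
          simp [hp, h1]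
        · have : ¬ IsCons e q' p := fun h => hqq (hp.eq_and_eq h).2
          simp [this, hqq]
      · intro r _ hr
        have : ¬ IsCons e q r := fun h => hr (h.right_unique hp)
        simp [this]
      · simp
    · have h1 : ¬ q.1 = e.right := fun h => hq (IsCons.exists_iff.mpr h)
      have h2 : ∀ p, ¬ IsCons e q p := fun p h => hq ⟨p, h⟩
      simp [h1, h2]
  have hSS' : ∀ e, S e * star (S e) = D fun p => ∃ q, IsCons e q p := by
    intro e
    ext p p'
    simp only [CStarMatrix.mul_apply, CStarMatrix.star_apply, hDapp, hSapp]
    by_cases hp : ∃ q, IsCons e q p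
    · obtain ⟨q, hq⟩ := hp
      rw [Finset.sum_eq_single q]
      · by_cases hpp : p = p'
        · subst hpp
          have : ∃ q, IsCons e q p := ⟨q, hq⟩
          simp [hq, this]
        · have : ¬ IsCons e q p' := fun h => hpp (hq.right_unique h)
          simp [this, hpp]
      · intro r _ hr
        have : ¬ IsCons e r p := fun h => hr (h.eq_and_eq hq).2
        simp [this]
      · simp
    · have h2 : ∀ q, ¬ IsCons e q p := fun q h => hp ⟨q, h⟩
      simp [h2]
  have hSD : ∀ e, S e * D (fun p => p.1 = e.right) = S e := by
    intro e
    ext p q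
    rw [CStarMatrix.mul_apply, Finset.sum_eq_single q]
    · simp only [hDapp, hSapp]
      by_cases h : IsCons e q p
      · simp [h, IsCons.exists_iff.mp ⟨p, h⟩]
      · simp [h]
    · intro r _ hr
      simp [hDapp, hr]
    · simp
  exact
    { P := fun x => D fun p => p.1 = x
      S := S
      proj := fun x => ⟨by
        change _ * _ = _
        rw [hDD]
        simp, hDstar _⟩
      orth := fun x x' h => by
        rw [hDD]
        exact hD0 _ fun p hp => h (hp.1.symm.trans hp.2)
      partial_isometry := fun e => by rw [mul_assoc, hSS, hSD]
      range_orth := fun e f h => by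
        rw [hSS', hSS', hDD]
        refine hD0 _ ?_
        rintro p ⟨⟨q, hq⟩, ⟨q', hq'⟩⟩
        exact h (hq.eq_and_eq hq').1
      star_S_mul_S := hSS
      range_le := fun e => by
        rw [hSS', hDD]
        congr 1
        ext p
        exact and_iff_right_of_imp fun ⟨q, hq⟩ => hq.fst_eq
      sum_range := fun x _ hx => by
        simp only [hSS']
        ext p q
        let ev : CStarMatrix (Σ x, PathTo y x) (Σ x, PathTo y x) ℂ →+ ℂ :=
          ⟨⟨fun M => M p q, rfl⟩, fun _ _ => rfl⟩
        have hsum : (∑ e : {e : Quiver.Total V // e.left = x}, D fun p => ∃ q, IsCons e.1 q p) p q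
            = ∑ e : {e : Quiver.Total V // e.left = x}, D (fun p => ∃ q, IsCons e.1 q p) p q :=
          map_sum ev _ _
        rw [hsum]
        simp only [hDapp]
        by_cases hp : p.1 = x
        -- As `x` emits an edge and `y` is a sink, a path starting at `x` is nontrivial and has
        -- exactly one first edge; only that edge contributes.
        · obtain ⟨e, r, hr⟩ := IsCons.exists_of_ne (p := p) (fun h => by
            obtain ⟨e⟩ := hx
            exact hy e.1 (e.2.trans (hp.symm.trans h)))
          rw [Finset.sum_eq_single ⟨e, hr.fst_eq.symm.trans hp⟩]
          · have : ∃ q, IsCons e q p := ⟨r, hr⟩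
            simp [hp, this]
          · rintro f _ hf
            have : ¬ ∃ q, IsCons f.1 q p := fun ⟨q, hq⟩ => hf (Subtype.ext (hq.eq_and_eq hr).1)
            simp [this]
          · simp
        · have : ∀ e : {e : Quiver.Total V // e.left = x}, ¬ ∃ q, IsCons e.1 q p :=
            fun e ⟨q, hq⟩ => hp (hq.fst_eq.trans e.2)
          simp [hp, this] }

lemma pathFamily_P_apply {y : V} (hy : IsSink y) [Fintype (Σ x, PathTo y x)] :
    (pathFamily hy).P y ⟨y, .nil⟩ ⟨y, .nil⟩ = 1 :=
  if_pos ⟨rfl, rfl⟩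

/-- The projection of a sink in the C*-algebra of a finite acyclic graph is nonzero. -/
theorem genP_ne_zero [Finite V] [∀ x y : V, Finite (x ⟶ y)] (hE : IsAcyclic V)
    {y : V} (hy : IsSink y) : (genP y : CStar V) ≠ 0 := by
  classical
  have := hE.finite_pathTo y
  have := Fintype.ofFinite (Σ x, PathTo y x)
  intro h
  have h1 : (pathFamily hy).P y = 0 := by
    have := congrArg (eval ⟨_, pathFamily hy⟩) h
    rwa [eval_genP, map_zero] at this
  have h2 := pathFamily_P_apply hy
  rw [h1] at h2
  exact zero_ne_one h2

end PathRep

/-! ### Freeness -/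

/-- The closed linear span of the `S_p`, where `p` runs through the paths that end at `y`. -/
def pathSpan (y : V) : Submodule ℂ (CStar V) :=
  (Submodule.span ℂ {a | ∃ (x : V) (p : PathTo y x),
    a = (universalFamily (V := V)).pathS p}).topologicalClosure

lemma pathS_mem_pathSpan {y x : V} (p : PathTo y x) :
    (universalFamily (V := V)).pathS p ∈ pathSpan y :=
  Submodule.le_topologicalClosure _ (Submodule.subset_span ⟨x, p, rfl⟩)

/-- A closed submodule contains `f w` for all `w` in `pathSpan y` if it does for `w = S_p`. -/
lemma map_mem_of_mem_pathSpan {y : V} (f : CStar V →L[ℂ] CStar V) {M : Submodule ℂ (CStar V)}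
    (hM : IsClosed (M : Set (CStar V)))
    (h : ∀ (x : V) (p : PathTo y x), f ((universalFamily (V := V)).pathS p) ∈ M)
    {w : CStar V} (hw : w ∈ pathSpan y) : f w ∈ M := by
  have hle : pathSpan y ≤ M.comap (f : CStar V →ₗ[ℂ] CStar V) := by
    refine Submodule.topologicalClosure_minimal _ (Submodule.span_le.mpr ?_)
      (hM.preimage f.continuous)
    rintro _ ⟨x, p, rfl⟩
    exact h x p
  exact hle hw

/-- The span is a left ideal: `S_e` prepends an edge, `S_e*` removes one or gives `0`, and `S_e* P_y
= 0` because `y` is a sink. Hence `b * P_y` lies in it for every `b`. -/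
lemma mul_mem_pathSpan {y : V} (hy : IsSink y) (a : CStar V) {w : CStar V}
    (hw : w ∈ pathSpan y) : a * w ∈ pathSpan y := by
  set F := universalFamily (V := V)
  have hcl : IsClosed (pathSpan y : Set (CStar V)) := Submodule.isClosed_topologicalClosure _
  have hgen : ∀ b : CStar V, (∀ (x : V) (p : PathTo y x), b * F.pathS p ∈ pathSpan y) →
      ∀ w ∈ pathSpan y, b * w ∈ pathSpan y := fun b hb w hw =>
    map_mem_of_mem_pathSpan (ContinuousLinearMap.mul ℂ (CStar V) b) hcl hb hw
  have hP : ∀ x, ∀ w ∈ pathSpan y, F.P x * w ∈ pathSpan y := by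
    intro x
    refine hgen _ fun x' p => ?_
    by_cases hx : x = x'
    · subst hx
      rw [F.P_mul_pathS]
      exact pathS_mem_pathSpan p
    · rw [F.P_mul_pathS_of_ne p hx]
      exact zero_mem _
  have hS : ∀ e, ∀ w ∈ pathSpan y, F.S e * w ∈ pathSpan y := by
    intro e
    refine hgen _ fun x' p => ?_
    by_cases hx : e.right = x'
    · subst hx
      exact pathS_mem_pathSpan (.cons e p)
    · rw [← F.S_mul_P, mul_assoc, F.P_mul_pathS_of_ne p hx, mul_zero]
      exact zero_mem _
  have hS' : ∀ e, ∀ w ∈ pathSpan y, star (F.S e) * w ∈ pathSpan y := by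
    intro e
    refine hgen _ fun x' p => ?_
    cases p with
    | nil =>
      have h1 : star (F.S e) * F.P y = 0 := by
        simpa [F.star_P] using congrArg star (F.P_mul_S_of_ne (hy e))
      rw [Family.pathS, h1]
      exact zero_mem _
    | cons f p =>
      rw [Family.pathS, ← mul_assoc]
      by_cases hef : e = f
      · subst hef
        rw [F.star_S_mul_S, F.P_mul_pathS]
        exact pathS_mem_pathSpan p
      · rw [F.star_S_mul_S_of_ne hef, zero_mul]
        exact zero_mem _
  -- The claim is carried for `a` and `star a` together so that the induction passes through
  -- adjoints.
  have main : ∀ w ∈ pathSpan y, a * w ∈ pathSpan y ∧ star a * w ∈ pathSpan y := by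
    refine closure_induction (p := fun a => ∀ w ∈ pathSpan y,
      a * w ∈ pathSpan y ∧ star a * w ∈ pathSpan y) ?_ ?_ ?_ ?_ ?_ ?_ ?_ ?_ a
    · intro x w hw
      refine ⟨hP x w hw, ?_⟩
      change star (F.P x) * w ∈ _
      rw [F.star_P]
      exact hP x w hw
    · exact fun e w hw => ⟨hS e w hw, hS' e w hw⟩
    · simp
    · intro a b ha hb w hw
      rw [star_add, add_mul, add_mul]
      exact ⟨add_mem (ha w hw).1 (hb w hw).1, add_mem (ha w hw).2 (hb w hw).2⟩
    · intro a b ha hb w hw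
      rw [star_mul, mul_assoc, mul_assoc]
      exact ⟨(ha _ (hb w hw).1).1, (hb _ (ha w hw).2).2⟩
    · intro c a ha w hw
      rw [star_smul, smul_mul_assoc, smul_mul_assoc]
      exact ⟨Submodule.smul_mem _ _ (ha w hw).1, Submodule.smul_mem _ _ (ha w hw).2⟩
    · intro a ha w hw
      rw [star_star]
      exact ⟨(ha w hw).2, (ha w hw).1⟩
    · simp only [Set.ofPred_forall]
      refine isClosed_iInter fun w => isClosed_iInter fun _ => ?_
      exact (hcl.preimage (by fun_prop : Continuous fun a : CStar V => a * w)).inter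
        (hcl.preimage (by fun_prop : Continuous fun a : CStar V => star a * w))
  exact (main w hw).1

/-- If all paths to `y` are too short, `L` kills every `S_p`: it multiplies `S_p` by the sum of `z ^
(p.length + 1)`, and `0 < p.length + 1 < k`. -/
theorem exists_pathTo_of_isFree [Fintype V] [∀ x y : V, Finite (x ⟶ y)] (hE : IsAcyclic V)
    {k : ℕ} (hk : k ≠ 0) (hfree : (cyclicGaugeAction V k).IsFree) {y : V} (hy : IsSink y) :
    ∃ (x : V) (p : PathTo y x), p.length = k - 1 := by
  have := finite_cyclic hk
  have := Fintype.ofFinite (cyclic k)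
  by_contra! hcon
  have hlen : ∀ (x : V) (p : PathTo y x), p.length + 1 < k := by
    intro x p
    by_contra hp
    obtain ⟨x', q, hq⟩ := p.exists_length_eq (n := k - 1) (by omega)
    exact hcon x' q hq
  set F := universalFamily (V := V)
  -- the spectral projection onto the elements of degree `-1`
  let gaugeL (z : Circle) : CStar V →L[ℂ] CStar V :=
    ⟨{ toFun := gaugeHom z, map_add' := map_add _, map_smul' := fun c a => map_smul _ c a },
      continuous_hom (gaugeHom z)⟩
  let L : CStar V →L[ℂ] CStar V := ∑ z : cyclic k, ((z : Circle) : ℂ) • gaugeL z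
  have hLapp : ∀ a, L a = ∑ z : cyclic k, ((z : Circle) : ℂ) • gaugeHom (z : Circle) a := by
    intro a
    simp only [L, sum_apply, smul_apply]
    rfl
  have hL : ∀ w ∈ pathSpan y, L w = 0 := by
    intro w hw
    have := map_mem_of_mem_pathSpan (y := y) L (M := ⊥) (by simp) (fun x p => ?_) hw
    · simpa using this
    · rw [Submodule.mem_bot, hLapp]
      simp only [gaugeHom_pathS, smul_smul, ← pow_succ', ← Finset.sum_smul]
      rw [sum_cyclic_pow hk, zero_smul]
      exact fun hd => absurd (Nat.le_of_dvd (Nat.succ_pos _) hd) (not_le.mpr (hlen x p))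
  -- On a function `z ↦ a * α_z(b)` this is `a * L (b * P_y)`, because `P_y` is gauge invariant; so
  -- it vanishes on the span, and by freeness and continuity everywhere.
  let Λ : C(cyclic k, CStar V) → CStar V := fun f => ∑ z : cyclic k, ((z : Circle) : ℂ) • (f z * F.P y)
  have hΛ : ∀ f, Λ f = 0 := by
    have hcont : Continuous Λ := by
      refine continuous_finsetSum _ fun z _ => ?_
      have hz : Continuous fun f : C(cyclic k, CStar V) => f z := by fun_prop
      exact (hz.mul continuous_const).const_smul ((z : Circle) : ℂ)
    have hclosed : IsClosed {f | Λ f = 0} := isClosed_eq hcont continuous_const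
    refine fun f => hclosed.closure_subset_iff.mpr ?_ (hfree f)
    intro f hf
    induction hf using Submodule.span_induction with
    | zero => simp [Λ]
    | add f g _ _ hf hg =>
      have : Λ (f + g) = Λ f + Λ g := by simp [Λ, add_mul, Finset.sum_add_distrib]
      exact this.trans (by rw [hf, hg, add_zero])
    | smul c f _ hf =>
      have : Λ (c • f) = c • Λ f := by
        simp [Λ, Finset.smul_sum, smul_comm c]
      exact this.trans (by rw [hf, smul_zero])
    | mem f hf =>
      obtain ⟨a, b, hab⟩ := hf
      have h1 : Λ f = a * L (b * F.P y) := by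
        rw [hLapp, Finset.mul_sum]
        refine Finset.sum_congr rfl fun z _ => ?_
        rw [hab, map_mul, mul_smul_comm, ← mul_assoc]
        rfl
      refine h1.trans ?_
      rw [hL, mul_zero]
      exact mul_mem_pathSpan hy b (pathS_mem_pathSpan (.nil : PathTo y y))
  -- The function `z ↦ z̄ P_y` has degree `-1`, so `Λ` takes it to `k • P_y`.
  have h0 := hΛ ⟨fun z => star ((z : Circle) : ℂ) • F.P y, by fun_prop⟩
  have h1 : ∀ z : cyclic k, ((z : Circle) : ℂ) * star ((z : Circle) : ℂ) = 1 := by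
    intro z
    simpa using Complex.mul_conj ((z : Circle) : ℂ)
  simp only [Λ, ContinuousMap.coe_mk, smul_mul_assoc, F.P_mul_P_self, smul_smul, h1, one_smul,
    Finset.sum_const, Finset.card_univ] at h0
  rw [← Nat.cast_smul_eq_nsmul ℂ, card_cyclic hk] at h0
  exact genP_ne_zero hE hy ((smul_eq_zero.mp h0).resolve_left (by exact_mod_cast hk))

end GraphCStar

/-! ### The equivalence of the three conditions -/

theorem mainTheorem9 {V : Type u} [Quiver.{v} V] [Fintype V] [∀ x y : V, Finite (x ⟶ y)]
    (hE : GraphCStar.IsAcyclic V) (k : ℕ) (hk : 1 ≤ k) :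
    List.TFAE
      [(GraphCStar.cyclicGaugeAction V k).IsFree,
        GraphCStar.weakLocalTrivDim (GraphCStar.cyclicGaugeAction V k) < ⊤,
        ∀ y : V, GraphCStar.IsSink y →
          ∃ (x : V) (p : Quiver.Path x y), p.length = k - 1] := by
  have hk0 : k ≠ 0 := by omega
  simp only [GraphCStar.exists_path_length_iff]
  tfae_have 1 → 3 := fun h y hy => GraphCStar.exists_pathTo_of_isFree hE hk0 h hy
  tfae_have 3 → 2 := fun h => by
    obtain ⟨n, hn⟩ := GraphCStar.exists_hasWeakTrivialization hE hk0 h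
    exact sInf_lt_iff.mpr ⟨n, ⟨n, rfl, hn⟩, ENat.natCast_lt_top n⟩
  tfae_have 2 → 1 := fun h => by
    obtain ⟨_, ⟨n, -, hn⟩, -⟩ := sInf_lt_iff.mp h
    have := GraphCStar.finite_cyclic hk0
    have := Fintype.ofFinite (GraphCStar.cyclic k)
    exact GraphCStar.isFree_of_hasWeakTrivialization hn
  tfae_finish

end
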